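/- Let $G=(V(G),E(G))$ be a finite or countably infinite, connected, simple, undirected, unweighted graph whose vertex degrees $d(v)$ are bounded from above. Let $L_2(G)$ be the Hilbert space of functions $f:V(G)\to\mathbb{C}$ with $\|f\|=\big(\sum_{v}|f(v)|^2\big)^{1/2}<\infty$, and let $\mathcal{L}$ be the bounded self-adjoint operator on $L_2(G)$ $$\mathcal{L}f(v)=\frac{1}{\sqrt{d(v)}}\sum_{u\sim v}\left(\frac{f(v)}{\sqrt{d(v)}}-\frac{f(u)}{\sqrt{d(u)}}\right)$$ (read as $0$ at a vertex without neighbours). For $\omega>0$, let $PW_\omega(G)$ be the set of $f\in L_2(G)$ whose spectral transform with respect to $\mathcal{L}$ is supported in $[0,\omega]$; that is, the spectral measure $\mu_f$ of $\mathcal{L}$ at $f$, determined by $\int\varphi\,d\mu_f=\langle\varphi(\mathcal{L})f,f\rangle$ for continuous compactly supported $\varphi:\mathbb{R}\to\mathbb{R}$, satisfies $\mu_f(\mathbb{R}\setminus[0,\omega])=0$. A set $U\subset V(G)$ is a uniqueness set for $PW_\omega(G)$ if any two functions in $PW_\omega(G)$ that coincide on $U$ coincide on $V(G)$. For $\Lambda>0$,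 a set $S\subset V(G)$ is a $\Lambda$-set if $\|\varphi\|\le\Lambda\|\mathcal{L}\varphi\|$ for every $\varphi\in L_2(G)$ that vanishes outside $S$. **Theorem.** If $S\subset V(G)$ is a $\Lambda$-set, then $U=V(G)\setminus S$ is a uniqueness set for $PW_\omega(G)$ for every $\omega$ with $0<\omega<1/\Lambda$. -/

import Mathlib

open scoped CompactlySupported

namespace PaleyWienerGraph

noncomputable section

/-! ### The spectral measure of an operator at a vector -/

section Spectral

variable {H : Type*} [NormedAddCommGroup H] [InnerProductSpace ℂ H] [CompleteSpace H]

/-- The positive linear functional `φ ↦ Re ⟨φ(T) f, f⟩` on compactly supported continuous functions,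
where `φ(T)` is given by the continuous functional calculus of the (self-adjoint) operator `T`. -/
def spectralFunctional (T : H →L[ℂ] H) (f : H) : C_c(ℝ, ℝ) →ₚ[ℝ] ℝ :=
  PositiveLinearMap.mk₀
    { toFun := fun φ => (inner ℂ f (cfc (φ : ℝ → ℝ) T f)).re
      map_add' := fun φ ψ => by
        have h : cfc (⇑(φ + ψ)) T = cfc (⇑φ) T + cfc (⇑ψ) T :=
          cfc_add (a := T) (fun x => φ x) (fun x => ψ x)
            φ.continuous.continuousOn ψ.continuous.continuousOn
        rw [h]
        simp
      map_smul' := fun c φ => by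
        have h : cfc (⇑(c • φ)) T = c • cfc (⇑φ) T :=
          cfc_smul (a := T) c (fun x => φ x) φ.continuous.continuousOn
        rw [h]
        simp }
    (fun φ hφ => by
      have h : 0 ≤ cfc (⇑φ) T := cfc_nonneg (fun x _ => hφ x)
      have h2 := ((ContinuousLinearMap.nonneg_iff_isPositive _).1 h).re_inner_nonneg_right f
      simpa using h2)

/-- The spectral measure `μ_f` of the self-adjoint operator `T` at the vector `f`: the Borel measure
on `ℝ` with `∫ φ dμ_f = ⟨φ(T) f, f⟩` for every `φ`. If `P` is the resolution of identity of `T`, then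
`μ_f(B) = ‖P(B) f‖²`; if `F` is a unitary map onto a direct integral `∫ X(τ) dm(τ)` that turns `T`
into multiplication by `τ`, then `dμ_f(τ) = ‖(F f)(τ)‖² dm(τ)`. -/
def spectralMeasure (T : H →L[ℂ] H) (f : H) : MeasureTheory.Measure ℝ :=
  RealRMK.rieszMeasure (spectralFunctional T f)

end Spectral

/-! ### The Laplace operator on `L₂(G)` -/

section Graph

variable {V : Type*}

/-- The Hilbert space `L₂(G)` of square summable complex functions on the vertices. -/
abbrev L2 (V : Type*) : Type _ := lp (fun _ : V => ℂ) 2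

variable (G : SimpleGraph V) [G.LocallyFinite]

/-- The normalized Laplacian
`𝓛 f (v) = d(v)^(-1/2) ∑_{u ∼ v} (f(v) / d(v)^(1/2) - f(u) / d(u)^(1/2))`. -/
def laplacianFun (f : V → ℂ) (v : V) : ℂ :=
  1 / (√(G.degree v : ℝ) : ℂ) *
    ∑ u ∈ G.neighborFinset v, (f v / (√(G.degree v : ℝ) : ℂ) - f u / (√(G.degree u : ℝ) : ℂ))

theorem norm_inv_sqrt_le (n : ℕ) (z : ℂ) : ‖z / (√(n : ℝ) : ℂ)‖ ≤ ‖z‖ := by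
  rw [norm_div, Complex.norm_real, Real.norm_of_nonneg (Real.sqrt_nonneg _)]
  rcases Nat.eq_zero_or_pos n with h | h
  · simp [h]
  · apply div_le_self (norm_nonneg _)
    rw [Real.one_le_sqrt]
    exact_mod_cast h

theorem norm_laplacianFun_sq_le {D : ℕ} (hD : ∀ v, G.degree v ≤ D) (f : V → ℂ) (v : V) :
    ‖laplacianFun G f v‖ ^ 2
      ≤ 2 * D * (D * ‖f v‖ ^ 2 + ∑ u ∈ G.neighborFinset v, ‖f u‖ ^ 2) := by
  have hd : (G.degree v : ℝ) ≤ D := by exact_mod_cast hD v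
  have h1 : ‖laplacianFun G f v‖ ≤ ∑ u ∈ G.neighborFinset v, (‖f v‖ + ‖f u‖) := by
    unfold laplacianFun
    rw [one_div, mul_comm, ← div_eq_mul_inv]
    refine (norm_inv_sqrt_le _ _).trans ((norm_sum_le _ _).trans ?_)
    refine Finset.sum_le_sum fun u _ => (norm_sub_le _ _).trans ?_
    exact add_le_add (norm_inv_sqrt_le _ _) (norm_inv_sqrt_le _ _)
  have hS : 0 ≤ ∑ u ∈ G.neighborFinset v, ‖f u‖ ^ 2 := by positivity
  calc ‖laplacianFun G f v‖ ^ 2 ≤ (∑ u ∈ G.neighborFinset v, (‖f v‖ + ‖f u‖)) ^ 2 := by gcongr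
    _ ≤ (G.neighborFinset v).card * ∑ u ∈ G.neighborFinset v, (‖f v‖ + ‖f u‖) ^ 2 :=
        sq_sum_le_card_mul_sum_sq
    _ ≤ D * ∑ u ∈ G.neighborFinset v, (2 * ‖f v‖ ^ 2 + 2 * ‖f u‖ ^ 2) := by
        rw [G.card_neighborFinset_eq_degree]
        gcongr with u hu
        nlinarith [sq_nonneg (‖f v‖ - ‖f u‖)]
    _ = D * (2 * G.degree v * ‖f v‖ ^ 2 + 2 * ∑ u ∈ G.neighborFinset v, ‖f u‖ ^ 2) := by
        rw [Finset.sum_add_distrib, Finset.sum_const, G.card_neighborFinset_eq_degree,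
          ← Finset.mul_sum, nsmul_eq_mul]
        ring
    _ ≤ D * (2 * D * ‖f v‖ ^ 2 + 2 * ∑ u ∈ G.neighborFinset v, ‖f u‖ ^ 2) := by gcongr
    _ = _ := by ring

theorem L2_sum_sq_le (f : L2 V) (s : Finset V) : ∑ v ∈ s, ‖f v‖ ^ 2 ≤ ‖f‖ ^ 2 := by
  have h := lp.sum_rpow_le_norm_rpow (p := 2) (by norm_num) f s
  simpa using h

theorem sum_norm_laplacianFun_sq_le {D : ℕ} (hD : ∀ v, G.degree v ≤ D) (f : L2 V)
    (s : Finset V) : ∑ v ∈ s, ‖laplacianFun G f v‖ ^ 2 ≤ (2 * D * ‖f‖) ^ 2 := by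
  classical
  have h2 : ∑ v ∈ s, ∑ u ∈ G.neighborFinset v, ‖f u‖ ^ 2 ≤ D * ‖f‖ ^ 2 := by
    rw [Finset.sum_comm' (t' := s.biUnion fun v => G.neighborFinset v)
      (s' := fun u => {v ∈ s | G.Adj v u})
      (by intro x y; simp only [Finset.mem_biUnion, Finset.mem_filter, G.mem_neighborFinset]
          constructor
          · rintro ⟨a, b⟩; exact ⟨⟨a, b⟩, x, a, b⟩
          · rintro ⟨a, _⟩; exact a)]
    calc _ ≤ ∑ u ∈ s.biUnion (fun v => G.neighborFinset v), D * ‖f u‖ ^ 2 := by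
          refine Finset.sum_le_sum fun u _ => ?_
          rw [Finset.sum_const, nsmul_eq_mul]
          gcongr
          refine le_trans ?_ (hD u)
          rw [← G.card_neighborFinset_eq_degree]
          refine Finset.card_le_card fun w hw => ?_
          rw [G.mem_neighborFinset]
          exact (Finset.mem_filter.1 hw).2.symm
      _ ≤ _ := by rw [← Finset.mul_sum]; gcongr; exact L2_sum_sq_le f _
  calc _ ≤ ∑ v ∈ s, 2 * D * (D * ‖f v‖ ^ 2 + ∑ u ∈ G.neighborFinset v, ‖f u‖ ^ 2) :=
        Finset.sum_le_sum fun v _ => norm_laplacianFun_sq_le G hD f v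
    _ = 2 * D * (D * ∑ v ∈ s, ‖f v‖ ^ 2 + ∑ v ∈ s, ∑ u ∈ G.neighborFinset v, ‖f u‖ ^ 2) := by
        rw [← Finset.mul_sum, Finset.sum_add_distrib, Finset.mul_sum]
    _ ≤ 2 * D * (D * ‖f‖ ^ 2 + D * ‖f‖ ^ 2) := by gcongr; exact L2_sum_sq_le f s
    _ = _ := by ring

theorem exists_degree_bound {G : SimpleGraph V} [G.LocallyFinite]
    (hG : BddAbove (Set.range fun v => G.degree v)) : ∃ D : ℕ, ∀ v, G.degree v ≤ D :=
  hG.imp fun _ hD v => hD ⟨v, rfl⟩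

variable {G}

theorem memℓp_laplacianFun (hG : BddAbove (Set.range fun v => G.degree v)) (f : L2 V) :
    Memℓp (fun v => laplacianFun G f v) 2 := by
  obtain ⟨D, hD⟩ := exists_degree_bound hG
  refine memℓp_gen' (C := (2 * D * ‖f‖) ^ 2) fun s => ?_
  simpa using sum_norm_laplacianFun_sq_le G hD f s

/-- The discrete Laplace operator `𝓛` of a graph with bounded degrees, as a bounded operator
on `L₂(G)`. -/
def laplacian (hG : BddAbove (Set.range fun v => G.degree v)) : L2 V →L[ℂ] L2 V :=
  LinearMap.mkContinuousOfExistsBound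
    { toFun := fun f => ⟨fun v => laplacianFun G f v, memℓp_laplacianFun hG f⟩
      map_add' := fun f g => by
        ext v
        simp only [laplacianFun, lp.coeFn_add, Pi.add_apply]
        rw [← mul_add, ← Finset.sum_add_distrib]
        congr 1
        exact Finset.sum_congr rfl fun u _ => by ring
      map_smul' := fun c f => by
        ext v
        simp only [laplacianFun, lp.coeFn_smul, Pi.smul_apply, smul_eq_mul, RingHom.id_apply]
        rw [mul_left_comm, Finset.mul_sum (a := c)]
        congr 1
        exact Finset.sum_congr rfl fun u _ => by ring }
    (by
      obtain ⟨D, hD⟩ := exists_degree_bound hG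
      refine ⟨2 * D, fun f => ?_⟩
      refine lp.norm_le_of_forall_sum_le (by norm_num) (by positivity) fun s => ?_
      simpa using sum_norm_laplacianFun_sq_le G hD f s)

theorem laplacian_apply (hG : BddAbove (Set.range fun v => G.degree v)) (f : L2 V) (v : V) :
    laplacian hG f v = laplacianFun G f v := rfl

/-! ### Paley-Wiener spaces, uniqueness sets and `Λ`-sets -/

/-- The Paley-Wiener space `PW_ω(G)`: the functions in `L₂(G)` whose spectral transform with respect
to `𝓛` is supported in `[0, ω]`, that is, whose spectral measure vanishes off `[0, ω]`. -/
def paleyWiener (hG : BddAbove (Set.range fun v => G.degree v)) (ω : ℝ) : Set (L2 V) :=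
  {f | spectralMeasure (laplacian hG) f (Set.Icc 0 ω)ᶜ = 0}

/-- `U` is a uniqueness set for `PW_ω(G)`. -/
def IsUniquenessSet (hG : BddAbove (Set.range fun v => G.degree v)) (ω : ℝ) (U : Set V) : Prop :=
  ∀ f ∈ paleyWiener hG ω, ∀ g ∈ paleyWiener hG ω, (∀ v ∈ U, f v = g v) → ∀ v, f v = g v

/-- `L₂(S)`: the functions in `L₂(G)` that vanish outside `S`. -/
def L2Supported (S : Set V) : Set (L2 V) :=
  {φ | ∀ v ∉ S, φ v = 0}

/-- `S` is a `Λ`-set: the Poincaré inequality with constant `Λ > 0` holds on `L₂(S)`. -/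
def IsLambdaSet (hG : BddAbove (Set.range fun v => G.degree v)) (S : Set V) (Λ : ℝ) : Prop :=
  0 < Λ ∧ ∀ φ ∈ L2Supported S, ‖φ‖ ≤ Λ * ‖laplacian hG φ‖

end Graph

end

end PaleyWienerGraph

namespace PaleyWienerGraph

section Spectral

variable {H : Type*} [NormedAddCommGroup H] [InnerProductSpace ℂ H] [CompleteSpace H]

/-! Let `h = f - g`, where `f` and `g` lie in `PW_ω` and agree off `S`. The Poincaré inequality on
`S` gives `‖h‖ ≤ Λ ‖𝓛 h‖`, the Bernstein inequality gives `‖𝓛 h‖ ≤ ω ‖h‖`, and `Λ ω < 1` forces `h =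
0`. The work is in the Bernstein inequality. The spectral measure is not additive in the vector, so
its vanishing off `[0, ω]` is first turned into a linear condition: `φ(𝓛) f = 0` whenever `φ`
vanishes on `[0, ω]` (`cfc_apply_eq_zero_of_spectralMeasure_compl`). This passes to `f - g`, and it
lets `𝓛` be replaced, on such a vector, by an operator of norm at most `ω`
(`norm_apply_le_of_cfc_apply_eq_zero`). -/

theorem integral_spectralMeasure (T : H →L[ℂ] H) (f : H) (φ : C_c(ℝ, ℝ)) :
    ∫ x, φ x ∂(spectralMeasure T f) = (inner ℂ f (cfc (φ : ℝ → ℝ) T f)).re :=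
  RealRMK.integral_rieszMeasure (spectralFunctional T f) φ

/-- If the spectral measure at `f` is carried by `K`, then `φ(T) f = 0` for every compactly
supported continuous `φ` vanishing on `K`. -/
theorem cfc_apply_eq_zero_of_spectralMeasure_compl {T : H →L[ℂ] H} {f : H} {K : Set ℝ}
    (hf : spectralMeasure T f Kᶜ = 0) (φ : C_c(ℝ, ℝ))
    (hφ : ∀ x ∈ K, φ x = 0) : cfc (φ : ℝ → ℝ) T f = 0 := by
  -- The test function is `φ²` because its integral is `‖φ(T) f‖²`.
  have hint : ∫ x, (φ * φ) x ∂(spectralMeasure T f) = 0 := by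
    refine MeasureTheory.integral_eq_zero_of_ae ?_
    have hae : ∀ᵐ x ∂(spectralMeasure T f), x ∈ K := hf
    filter_upwards [hae] with x hx
    simp [hφ x hx]
  rw [integral_spectralMeasure] at hint
  have hmul : cfc (⇑(φ * φ)) T = cfc (φ : ℝ → ℝ) T * cfc (φ : ℝ → ℝ) T :=
    cfc_mul (fun x => φ x) (fun x => φ x) T φ.continuous.continuousOn φ.continuous.continuousOn
  -- This needs nothing about `T`: if `T` is not self-adjoint, `cfc` takes the default value `0`.
  have hsa : IsSelfAdjoint (cfc (φ : ℝ → ℝ) T) := cfc_predicate _ _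
  rw [hmul, mul_apply_eq_comp, ← hsa.isSymmetric.apply_clm] at hint
  have hn : ‖cfc (φ : ℝ → ℝ) T f‖ ^ 2 = 0 := by
    rw [← hint]
    exact (inner_self_eq_norm_sq (𝕜 := ℂ) _).symm
  simpa using hn

/-- A vector annihilated by all `φ(T)`, `φ` vanishing on `[0, ω]`, satisfies the Bernstein
inequality. -/
theorem norm_apply_le_of_cfc_apply_eq_zero {T : H →L[ℂ] H} (hT : IsSelfAdjoint T) {h : H} {ω : ℝ}
    (hω : 0 ≤ ω)
    (hh : ∀ φ : C_c(ℝ, ℝ), (∀ x ∈ Set.Icc 0 ω, φ x = 0) →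
      cfc (φ : ℝ → ℝ) T h = 0) :
    ‖T h‖ ≤ ω * ‖h‖ := by
  -- Truncation to `[0, ω]`: `x - c x` vanishes on that interval, so `T h = c(T) h`, while `|c| ≤
  -- ω`.
  let c : ℝ → ℝ := fun x => max 0 (min x ω)
  have hc : Continuous c := by fun_prop
  -- The cutoff `χ`, equal to `1` on the spectrum, makes `x - c x` compactly supported without
  -- changing its value at `T`.
  obtain ⟨χ, hχ1, -, hχc, -⟩ := exists_continuous_one_zero_of_isCompact
    (spectrum.isCompact (𝕜 := ℝ) T) isClosed_empty (Set.disjoint_empty _)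
  let φ : C_c(ℝ, ℝ) :=
    ⟨⟨fun x => χ x * (x - c x), by fun_prop⟩, hχc.mul_right⟩
  have h0 : cfc (φ : ℝ → ℝ) T h = 0 := hh φ fun x hx => by
    change χ x * (x - max 0 (min x ω)) = 0
    rw [min_eq_left hx.2, max_eq_right hx.1, sub_self, mul_zero]
  have h1 : cfc (φ : ℝ → ℝ) T = T - cfc c T := by
    have : cfc (φ : ℝ → ℝ) T = cfc (fun x => x - c x) T :=
      cfc_congr fun x hx => by
        change χ x * (x - c x) = x - c x
        rw [hχ1 hx, Pi.one_apply, one_mul]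
    rw [this, cfc_sub (fun x => x) c T, cfc_id' ℝ T]
  have h2 : T h = cfc c T h := by
    rw [h1, sub_apply, sub_eq_zero] at h0
    exact h0
  have h3 : ‖cfc c T‖ ≤ ω := norm_cfc_le hω fun x _ => by
    rw [Real.norm_of_nonneg (le_max_left _ _)]
    exact max_le hω (min_le_right _ _)
  rw [h2]
  exact (cfc c T).le_of_opNorm_le h3 h

end Spectral

section Graph

variable {V : Type*} {G : SimpleGraph V} [G.LocallyFinite]

/-- The matrix of `𝓛` is real and symmetric, with entries `-1 / √(d(v) d(w))` at adjacent `v`, `w`.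
Since `(𝓛* f)(v) = ⟨𝓛 δ_v, f⟩` and `𝓛 δ_v` lives on `v` and its neighbours, only finite sums need to
be compared. -/
theorem isSelfAdjoint_laplacian (hG : BddAbove (Set.range fun v => G.degree v)) :
    IsSelfAdjoint (laplacian hG) := by
  classical
  rw [ContinuousLinearMap.isSelfAdjoint_iff']
  ext f v
  have hsingle (g : L2 V) : g v = inner ℂ (lp.single 2 v (1 : ℂ) : L2 V) g := by
    rw [lp.inner_single_left]
    simp
  rw [hsingle, ContinuousLinearMap.adjoint_inner_right, lp.inner_eq_tsum,
    tsum_eq_sum (s := insert v (G.neighborFinset v)), Finset.sum_insert (by simp)]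
  -- The diagonal term stays a sum over neighbours, matching `laplacianFun` and covering isolated
  -- vertices as well.
  · have hd : inner ℂ (laplacian hG (lp.single 2 v (1 : ℂ)) v) (f v) =
        1 / (√(G.degree v : ℝ) : ℂ) *
          ∑ u ∈ G.neighborFinset v, f v / (√(G.degree v : ℝ) : ℂ) := by
      rw [laplacian_apply, laplacianFun,
        Finset.sum_congr rfl (g := fun _ => 1 / (√(G.degree v : ℝ) : ℂ))]
      · simp [Complex.conj_ofReal]
        ring
      · intro u hu
        have : u ≠ v := (G.ne_of_adj ((G.mem_neighborFinset _ _).1 hu)).symm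
        simp [lp.single_apply, this]
    have ho (w) (hw : w ∈ G.neighborFinset v) :
        inner ℂ (laplacian hG (lp.single 2 v (1 : ℂ)) w) (f w) =
          -(1 / (√(G.degree v : ℝ) : ℂ) * (f w / (√(G.degree w : ℝ) : ℂ))) := by
      have hadj : G.Adj v w := (G.mem_neighborFinset _ _).1 hw
      rw [laplacian_apply, laplacianFun, Finset.sum_eq_single v]
      · simp [lp.single_apply, hadj.ne', Complex.conj_ofReal]
        ring
      · intro u _ hu
        simp [lp.single_apply, hadj.ne', hu]
      · intro h
        exact absurd ((G.mem_neighborFinset _ _).2 hadj.symm) h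
    rw [hd, Finset.sum_congr rfl ho, laplacian_apply, laplacianFun, Finset.sum_sub_distrib,
      mul_sub, Finset.sum_neg_distrib, ← Finset.mul_sum, sub_eq_add_neg]
  · intro w hw
    rw [Finset.mem_insert, not_or, G.mem_neighborFinset] at hw
    have : laplacian hG (lp.single 2 v (1 : ℂ)) w = 0 := by
      rw [laplacian_apply, laplacianFun, Finset.sum_eq_zero, mul_zero]
      intro u hu
      have huv : u ≠ v := by
        rintro rfl
        exact hw.2 ((G.mem_neighborFinset _ _).1 hu).symm
      simp [lp.single_apply, huv, hw.1]
    rw [this, inner_zero_left]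

/-- The Bernstein inequality for differences of functions in the Paley-Wiener space. -/
theorem norm_laplacian_sub_le (hG : BddAbove (Set.range fun v => G.degree v)) {ω : ℝ} (hω : 0 ≤ ω)
    {f g : L2 V} (hf : f ∈ paleyWiener hG ω) (hg : g ∈ paleyWiener hG ω) :
    ‖laplacian hG (f - g)‖ ≤ ω * ‖f - g‖ :=
  norm_apply_le_of_cfc_apply_eq_zero (isSelfAdjoint_laplacian hG) hω fun φ hφ => by
    rw [map_sub, cfc_apply_eq_zero_of_spectralMeasure_compl hf φ hφ,
      cfc_apply_eq_zero_of_spectralMeasure_compl hg φ hφ, sub_zero]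

end Graph

end PaleyWienerGraph

theorem theorem1p1 {V : Type*} [Countable V] (G : SimpleGraph V) [G.LocallyFinite]
    (hconn : G.Connected) (hG : BddAbove (Set.range fun v => G.degree v))
    (S : Set V) (Λ : ℝ) (hS : PaleyWienerGraph.IsLambdaSet hG S Λ)
    (ω : ℝ) (hω : 0 < ω) (hωΛ : ω < 1 / Λ) :
    PaleyWienerGraph.IsUniquenessSet hG ω Sᶜ := by
  intro f hf g hg hfg v
  obtain ⟨hΛ, hS⟩ := hS
  have hsupp : f - g ∈ PaleyWienerGraph.L2Supported S := fun v hv => by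
    rw [lp.coeFn_sub, Pi.sub_apply, hfg v hv, sub_self]
  have h1 : ‖f - g‖ ≤ Λ * (ω * ‖f - g‖) :=
    (hS _ hsupp).trans (by gcongr; exact PaleyWienerGraph.norm_laplacian_sub_le hG hω.le hf hg)
  have h2 : ω * Λ < 1 := (lt_div_iff₀ hΛ).1 hωΛ
  -- `(1 - ω Λ) ‖f - g‖ ≤ 0` with a positive first factor.
  have h3 : ‖f - g‖ = 0 := by nlinarith [norm_nonneg (f - g)]
  rw [sub_eq_zero.1 (norm_eq_zero.1 h3)]
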